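/- Let $C$ be a higher rank graph, i.e. a countable category (regarded as the set of its arrows, $\mathbf{d}(a)$ and $\mathbf{r}(a)$ being the domain and codomain of $a$, with $ab$ defined iff $\mathbf{d}(a)=\mathbf{r}(b)$) with a functor $d\colon C\to\mathbb{N}^k$ such that whenever $d(a)=m+n$ there are unique $a_1,a_2\in C$ with $a=a_1a_2$, $d(a_1)=m$, $d(a_2)=n$. Suppose that $C$ has finitely many identities, has no sources (for each identity $e$ and $m\in\mathbb{N}^k$ there is $x\in eC$ with $d(x)=m$), is row finite (for each $e$ and $m$ there are only finitely many such $x$), and is strongly finitely aligned (each non-empty $xC\cap yC$ is equal to $XC$ for a finite set $X$ whose distinct elements are pairwise independent). Here $aC=\{ax : x\in C\}$, and $a,b\in C$ are dependent if $aC\cap bC\neq\varnothing$ and independent otherwise. Let $\mathsf{R}(C)$ be the inverse monoid, under composition of partial maps, of all bijections $\theta\colon XC\to YC$ with $X,Y\subseteq C$ finite (possibly empty) and $\theta(rs)=\theta(r)s$ for all $r\in XC$ and $s\in C$ for which $rs$ is defined. Let $\le$ be its natural partial order ($a\le b$ iff $a=ba^{-1}a$), and let $\equiv$ be the congruence on $\mathsf{R}(C)$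 with $s\equiv t$ iff for each $0\ne x\le s$ there is $z\neq 0$ with $z\le x$ and $z\le t$, and for each $0\neq y\le t$ there is $z\neq 0$ with $z\le y$ and $z\le s$. Put $\mathsf{B}(C)=\mathsf{R}(C)/{\equiv}$. Then the following are equivalent: 1. $C$ is cofinal: for all identities $e,f$ of $C$ there is a finite set $X\subseteq fC$ such that each element of $fC$ is dependent on an element of $X$, and for each $x\in X$ there is an arrow of $C$ with domain $\mathbf{d}(x)$ and codomain $e$. 2. $\mathsf{B}(C)$ is $0$-simplifying: its only additive ideals are $\{0\}$ and $\mathsf{B}(C)$. An additive ideal is a non-empty two-sided semigroup ideal $I$ such that $a\vee b\in I$ (the join for the natural partial order) whenever $a,b\in I$ are compatible, i.e. $a^{-1}b$ and $ab^{-1}$ are idempotents. -/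

import Mathlib

universe v u

namespace HigherRank

/-! ## Inverse monoids with zero -/

/-- An inverse monoid with zero: for every `a` there is exactly one `b` with `a = aba` and
`b = bab`, and this `b` is denoted by `a⁻¹`. -/
class InverseMonoidWithZero (S : Type*) extends MonoidWithZero S, Inv S where
  mul_inv_mul : ∀ a : S, a * a⁻¹ * a = a
  inv_mul_inv : ∀ a : S, a⁻¹ * a * a⁻¹ = a⁻¹
  inv_unique : ∀ a b : S, a * b * a = a → b * a * b = b → b = a⁻¹

/-- A semigroup has at most one inverse of each element when its idempotents commute. -/
theorem inverse_unique {S : Type*} [Semigroup S]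
    (hcomm : ∀ e f : S, e * e = e → f * f = f → e * f = f * e)
    {a b c : S} (h1 : a * b * a = a) (h2 : b * a * b = b) (h3 : a * c * a = a)
    (h4 : c * a * c = c) : b = c := by
  have iba : (b * a) * (b * a) = b * a := by rw [← mul_assoc, h2]
  have ica : (c * a) * (c * a) = c * a := by rw [← mul_assoc, h4]
  have iab : (a * b) * (a * b) = a * b := by rw [← mul_assoc, h1]
  have iac : (a * c) * (a * c) = a * c := by rw [← mul_assoc, h3]
  calc b = b * (a * c * a) * b := by rw [h3, h2]
    _ = ((b * a) * (c * a)) * b := by simp only [mul_assoc]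
    _ = ((c * a) * (b * a)) * b := by rw [hcomm _ _ iba ica]
    _ = c * a * (b * a * b) := by simp only [mul_assoc]
    _ = (c * a * c) * a * b := by rw [h2, h4]
    _ = c * ((a * c) * (a * b)) := by simp only [mul_assoc]
    _ = c * ((a * b) * (a * c)) := by rw [hcomm _ _ iac iab]
    _ = c * ((a * b * a) * c) := by simp only [mul_assoc]
    _ = c := by rw [h1, ← mul_assoc, h4]

section InverseMonoid

variable {S : Type*} [InverseMonoidWithZero S]

/-- The natural partial order: `a ≤ b` if and only if `a = b a⁻¹ a`. -/
def NatLE (a b : S) : Prop := a = b * (a⁻¹ * a)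

/-- The compatibility relation: `a⁻¹ b` and `a b⁻¹` are both idempotents. -/
def Compatible (a b : S) : Prop :=
  IsIdempotentElem (a⁻¹ * b) ∧ IsIdempotentElem (a * b⁻¹)

/-- `c` is the join `a ∨ b` with respect to the natural partial order. -/
def IsJoin (a b c : S) : Prop :=
  NatLE a c ∧ NatLE b c ∧ ∀ x : S, NatLE a x → NatLE b x → NatLE c x

/-- A (non-empty, two-sided) semigroup ideal. -/
def IsSemigroupIdeal (I : Set S) : Prop :=
  I.Nonempty ∧ ∀ a ∈ I, ∀ s : S, s * a ∈ I ∧ a * s ∈ I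

/-- An additive ideal: a semigroup ideal that contains the join `a ∨ b` of any two of its
elements `a` and `b` that are compatible. -/
def IsAdditiveIdeal (I : Set S) : Prop :=
  IsSemigroupIdeal I ∧ ∀ a ∈ I, ∀ b ∈ I, Compatible a b → ∃ c ∈ I, IsJoin a b c

variable (S) in
/-- `S` is `0`-simplifying: the only additive ideals are the trivial ones, `{0}` and `S`. -/
def IsZeroSimplifying : Prop :=
  ∀ I : Set S, IsAdditiveIdeal I → I = {0} ∨ I = Set.univ

/-- The relation `≡`: every `0 ≠ x ≤ s` has a non-zero element below it that is below `t`,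
and every `0 ≠ y ≤ t` has a non-zero element below it that is below `s`. -/
def LenzRel (s t : S) : Prop :=
  (∀ x : S, x ≠ 0 → NatLE x s → ∃ z : S, z ≠ 0 ∧ NatLE z x ∧ NatLE z t) ∧
  (∀ y : S, y ≠ 0 → NatLE y t → ∃ z : S, z ≠ 0 ∧ NatLE z y ∧ NatLE z s)

theorem idem_inv_mul (a : S) : (a⁻¹ * a) * (a⁻¹ * a) = a⁻¹ * a := by
  rw [← mul_assoc, InverseMonoidWithZero.inv_mul_inv]

theorem idem_mul_inv (a : S) : (a * a⁻¹) * (a * a⁻¹) = a * a⁻¹ := by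
  rw [← mul_assoc, InverseMonoidWithZero.mul_inv_mul]

theorem inv_inv_eq (a : S) : (a⁻¹)⁻¹ = a :=
  (InverseMonoidWithZero.inv_unique a⁻¹ a (InverseMonoidWithZero.inv_mul_inv a)
    (InverseMonoidWithZero.mul_inv_mul a)).symm

theorem idem_mul_idem {e f : S} (he : e * e = e) (hf : f * f = f) :
    (e * f) * (e * f) = e * f := by
  have h1 := InverseMonoidWithZero.mul_inv_mul (e * f)
  have h2 := InverseMonoidWithZero.inv_mul_inv (e * f)
  set x := (e * f)⁻¹ with hx
  have hy : f * x * e = x := by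
    apply InverseMonoidWithZero.inv_unique (e * f) (f * x * e)
    · calc e * f * (f * x * e) * (e * f) = e * (f * f) * x * (e * e) * f := by
            simp only [mul_assoc]
        _ = e * f * x * (e * f) := by rw [he, hf]; simp only [mul_assoc]
        _ = e * f := h1
    · calc f * x * e * (e * f) * (f * x * e) = f * x * (e * e) * (f * f) * x * e := by
            simp only [mul_assoc]
        _ = f * (x * (e * f) * x) * e := by rw [he, hf]; simp only [mul_assoc]
        _ = f * x * e := by rw [h2]
  have hxx : x * x = x := by
    calc x * x = (f * x * e) * (f * x * e) := by rw [hy]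
      _ = f * (x * (e * f) * x) * e := by simp only [mul_assoc]
      _ = x := by rw [h2, hy]
  have hxinv : x = x⁻¹ := InverseMonoidWithZero.inv_unique x x (by rw [hxx, hxx]) (by rw [hxx, hxx])
  have hef : e * f = x := by
    rw [hxinv, hx, inv_inv_eq]
  rw [hef, hxx]

theorem idem_comm {e f : S} (he : e * e = e) (hf : f * f = f) : e * f = f * e := by
  have hef := idem_mul_idem he hf
  have hfe := idem_mul_idem hf he
  have h1 : e * f = (e * f)⁻¹ :=
    InverseMonoidWithZero.inv_unique _ _ (by rw [hef, hef]) (by rw [hef, hef])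
  have h2 : f * e = (e * f)⁻¹ := by
    apply InverseMonoidWithZero.inv_unique
    · calc e * f * (f * e) * (e * f) = e * (f * f) * (e * e) * f := by simp only [mul_assoc]
        _ = (e * f) * (e * f) := by rw [he, hf]; simp only [mul_assoc]
        _ = e * f := hef
    · calc f * e * (e * f) * (f * e) = f * (e * e) * (f * f) * e := by simp only [mul_assoc]
        _ = (f * e) * (f * e) := by rw [he, hf]; simp only [mul_assoc]
        _ = f * e := hfe
  rw [h1, ← h2]

theorem natLE_of_eq_mul {a b e : S} (he : e * e = e) (h : a = b * e) : NatLE a b := by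
  have h1 : a * e = a := by rw [h, mul_assoc, he]
  unfold NatLE
  calc a = a * a⁻¹ * a := (InverseMonoidWithZero.mul_inv_mul a).symm
    _ = b * (e * (a⁻¹ * a)) := by nth_rewrite 1 [h]; simp only [mul_assoc]
    _ = b * ((a⁻¹ * a) * e) := by rw [idem_comm he (idem_inv_mul a)]
    _ = b * (a⁻¹ * (a * e)) := by simp only [mul_assoc]
    _ = b * (a⁻¹ * a) := by rw [h1]

theorem idem_conj {e : S} (he : e * e = e) (b : S) :
    (b⁻¹ * e * b) * (b⁻¹ * e * b) = b⁻¹ * e * b := by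
  calc (b⁻¹ * e * b) * (b⁻¹ * e * b) = b⁻¹ * (e * (b * b⁻¹)) * e * b := by simp only [mul_assoc]
    _ = b⁻¹ * ((b * b⁻¹) * e) * e * b := by rw [idem_comm he (idem_mul_inv b)]
    _ = (b⁻¹ * b * b⁻¹) * (e * e) * b := by simp only [mul_assoc]
    _ = b⁻¹ * e * b := by rw [he, InverseMonoidWithZero.inv_mul_inv]

theorem natLE_of_eq_mul_left {a b e : S} (he : e * e = e) (h : a = e * b) : NatLE a b := by
  apply natLE_of_eq_mul (idem_conj he b)
  calc a = e * (b * b⁻¹ * b) := by rw [InverseMonoidWithZero.mul_inv_mul, h]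
    _ = (e * (b * b⁻¹)) * b := by simp only [mul_assoc]
    _ = ((b * b⁻¹) * e) * b := by rw [idem_comm he (idem_mul_inv b)]
    _ = b * (b⁻¹ * e * b) := by simp only [mul_assoc]

theorem NatLE.eq_left {a b : S} (h : NatLE a b) : ∃ e : S, e * e = e ∧ a = e * b := by
  have hi := idem_inv_mul a
  unfold NatLE at h
  set f := a⁻¹ * a
  have hc := idem_conj hi b⁻¹
  rw [inv_inv_eq] at hc
  refine ⟨b * f * b⁻¹, hc, ?_⟩
  calc a = (b * b⁻¹ * b) * f := by rw [InverseMonoidWithZero.mul_inv_mul]; exact h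
    _ = b * ((b⁻¹ * b) * f) := by simp only [mul_assoc]
    _ = b * (f * (b⁻¹ * b)) := by rw [idem_comm (idem_inv_mul b) hi]
    _ = b * f * b⁻¹ * b := by simp only [mul_assoc]

theorem NatLE.trans {a b c : S} (h1 : NatLE a b) (h2 : NatLE b c) : NatLE a c := by
  apply natLE_of_eq_mul (idem_mul_idem (idem_inv_mul b) (idem_inv_mul a))
  rw [← mul_assoc, ← (show b = c * (b⁻¹ * b) from h2)]
  exact h1

theorem NatLE.refl (a : S) : NatLE a a := by
  unfold NatLE
  rw [← mul_assoc, InverseMonoidWithZero.mul_inv_mul]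

theorem LenzRel.refl (a : S) : LenzRel a a :=
  ⟨fun x hx h => ⟨x, hx, NatLE.refl x, h⟩, fun x hx h => ⟨x, hx, NatLE.refl x, h⟩⟩

theorem LenzRel.symm {a b : S} (h : LenzRel a b) : LenzRel b a := ⟨h.2, h.1⟩

theorem LenzRel.trans {a b c : S} (h : LenzRel a b) (h' : LenzRel b c) : LenzRel a c := by
  constructor
  · intro x hx hxa
    obtain ⟨z, hz, hzx, hzb⟩ := h.1 x hx hxa
    obtain ⟨w, hw, hwz, hwc⟩ := h'.1 z hz hzb
    exact ⟨w, hw, hwz.trans hzx, hwc⟩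
  · intro x hx hxc
    obtain ⟨z, hz, hzx, hzb⟩ := h'.2 x hx hxc
    obtain ⟨w, hw, hwz, hwa⟩ := h.2 z hz hzb
    exact ⟨w, hw, hwz.trans hzx, hwa⟩

theorem lenz_mul_left_aux {s t : S} (u : S)
    (h : ∀ x : S, x ≠ 0 → NatLE x s → ∃ z : S, z ≠ 0 ∧ NatLE z x ∧ NatLE z t) :
    ∀ x : S, x ≠ 0 → NatLE x (u * s) → ∃ z : S, z ≠ 0 ∧ NatLE z x ∧ NatLE z (u * t) := by
  intro x hx hxs
  have hf := idem_inv_mul x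
  have hxs' : x = u * s * (x⁻¹ * x) := hxs
  set f := x⁻¹ * x
  have huy : u * (u⁻¹ * x) = x := by
    calc u * (u⁻¹ * x) = u * (u⁻¹ * (u * s * f)) := by rw [← hxs']
      _ = (u * u⁻¹ * u) * s * f := by simp only [mul_assoc]
      _ = u * s * f := by rw [InverseMonoidWithZero.mul_inv_mul]
      _ = x := hxs'.symm
  have hy0 : u⁻¹ * x ≠ 0 := by
    intro h0
    rw [h0, mul_zero] at huy
    exact hx huy.symm
  have hys : NatLE (u⁻¹ * x) s := by
    have h1 : NatLE (u⁻¹ * x) ((u⁻¹ * u) * s) := by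
      apply natLE_of_eq_mul hf
      calc u⁻¹ * x = u⁻¹ * (u * s * f) := by rw [← hxs']
        _ = u⁻¹ * u * s * f := by simp only [mul_assoc]
    exact h1.trans (natLE_of_eq_mul_left (idem_inv_mul u) rfl)
  obtain ⟨z, hz, hzy, hzt⟩ := h _ hy0 hys
  have hg := idem_inv_mul z
  have hzy' : z = u⁻¹ * x * (z⁻¹ * z) := hzy
  have hzt' : z = t * (z⁻¹ * z) := hzt
  have hzz : u⁻¹ * (u * z) = z := by
    calc u⁻¹ * (u * z) = u⁻¹ * (u * (u⁻¹ * x * (z⁻¹ * z))) := by rw [← hzy']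
      _ = (u⁻¹ * u * u⁻¹) * x * (z⁻¹ * z) := by simp only [mul_assoc]
      _ = z := by rw [InverseMonoidWithZero.inv_mul_inv]; exact hzy'.symm
  refine ⟨u * z, ?_, ?_, ?_⟩
  · intro h0
    rw [h0, mul_zero] at hzz
    exact hz hzz.symm
  · apply natLE_of_eq_mul hg
    calc u * z = u * (u⁻¹ * x * (z⁻¹ * z)) := by rw [← hzy']
      _ = (u * (u⁻¹ * x)) * (z⁻¹ * z) := by simp only [mul_assoc]
      _ = x * (z⁻¹ * z) := by rw [huy]
  · apply natLE_of_eq_mul hg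
    rw [mul_assoc, ← hzt']

theorem lenz_mul_right_aux {s t : S} (u : S)
    (h : ∀ x : S, x ≠ 0 → NatLE x s → ∃ z : S, z ≠ 0 ∧ NatLE z x ∧ NatLE z t) :
    ∀ x : S, x ≠ 0 → NatLE x (s * u) → ∃ z : S, z ≠ 0 ∧ NatLE z x ∧ NatLE z (t * u) := by
  intro x hx hxs
  obtain ⟨f, hf, hxf⟩ := hxs.eq_left
  have hyu : x * u⁻¹ * u = x := by
    calc x * u⁻¹ * u = f * s * (u * u⁻¹ * u) := by rw [hxf]; simp only [mul_assoc]
      _ = x := by rw [InverseMonoidWithZero.mul_inv_mul, hxf]; simp only [mul_assoc]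
  have hy0 : x * u⁻¹ ≠ 0 := by
    intro h0
    rw [h0, zero_mul] at hyu
    exact hx hyu.symm
  have hys : NatLE (x * u⁻¹) s := by
    have h1 : NatLE (x * u⁻¹) (s * (u * u⁻¹)) := by
      apply natLE_of_eq_mul_left hf
      rw [hxf]; simp only [mul_assoc]
    exact h1.trans (natLE_of_eq_mul (idem_mul_inv u) rfl)
  obtain ⟨z, hz, hzy, hzt⟩ := h _ hy0 hys
  obtain ⟨g, hg, hzg⟩ := hzy.eq_left
  obtain ⟨p, hp, hzp⟩ := hzt.eq_left
  have hzz : z * u * u⁻¹ = z := by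
    calc z * u * u⁻¹ = g * x * (u⁻¹ * u * u⁻¹) := by rw [hzg]; simp only [mul_assoc]
      _ = z := by rw [InverseMonoidWithZero.inv_mul_inv, hzg]; simp only [mul_assoc]
  refine ⟨z * u, ?_, ?_, ?_⟩
  · intro h0
    rw [h0, zero_mul] at hzz
    exact hz hzz.symm
  · apply natLE_of_eq_mul_left hg
    calc z * u = g * (x * u⁻¹ * u) := by rw [hzg]; simp only [mul_assoc]
      _ = g * x := by rw [hyu]
  · apply natLE_of_eq_mul_left hp
    rw [hzp]; simp only [mul_assoc]

variable (S) in
/-- The Lenz congruence `≡`. -/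
def lenzCon : Con S where
  r := LenzRel
  iseqv := ⟨LenzRel.refl, LenzRel.symm, LenzRel.trans⟩
  mul' := by
    intro a b c d hab hcd
    have h1 : LenzRel (a * c) (b * c) :=
      ⟨lenz_mul_right_aux c hab.1, lenz_mul_right_aux c hab.2⟩
    have h2 : LenzRel (b * c) (b * d) :=
      ⟨lenz_mul_left_aux b hcd.1, lenz_mul_left_aux b hcd.2⟩
    exact h1.trans h2

/-- Idempotents commute in every quotient of an inverse monoid. -/
theorem con_idem_comm (c : Con S) (e f : c.Quotient) (he : e * e = e) (hf : f * f = f) :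
    e * f = f * e := by
  have lift : ∀ e : c.Quotient, e * e = e → ∃ a : S, a * a = a ∧ e = (a : c.Quotient) := by
    intro e he
    induction e using Con.induction_on with
    | H a =>
      have hi : (a * (a * a)⁻¹ * a) * (a * (a * a)⁻¹ * a) = a * (a * a)⁻¹ * a := by
        calc (a * (a * a)⁻¹ * a) * (a * (a * a)⁻¹ * a)
            = a * ((a * a)⁻¹ * (a * a) * (a * a)⁻¹) * a := by simp only [mul_assoc]
          _ = a * (a * a)⁻¹ * a := by rw [InverseMonoidWithZero.inv_mul_inv]
      refine ⟨_, hi, ?_⟩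
      have h2 := congrArg (fun x : S => (x : c.Quotient))
        (InverseMonoidWithZero.mul_inv_mul (a * a))
      simp only [Con.coe_mul] at h2 ⊢
      rw [he] at h2
      exact h2.symm
  obtain ⟨a, ha, rfl⟩ := lift e he
  obtain ⟨b, hb, rfl⟩ := lift f hf
  rw [← Con.coe_mul, ← Con.coe_mul, idem_comm ha hb]

/-- The quotient of an inverse monoid with zero by a congruence; the operations are those of
representatives. -/
instance quotientInverseMonoid (c : Con S) : InverseMonoidWithZero c.Quotient where
  zero := ((0 : S) : c.Quotient)
  zero_mul := by
    intro a
    induction a using Con.induction_on with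
    | H a => exact congrArg (fun x : S => (x : c.Quotient)) (zero_mul a)
  mul_zero := by
    intro a
    induction a using Con.induction_on with
    | H a => exact congrArg (fun x : S => (x : c.Quotient)) (mul_zero a)
  inv := fun q => Con.liftOn q (fun a => ((a⁻¹ : S) : c.Quotient)) (by
    intro a b hab
    have hab' : (a : c.Quotient) = (b : c.Quotient) := (Con.eq c).2 hab
    have ha1 := congrArg (fun x : S => (x : c.Quotient)) (InverseMonoidWithZero.mul_inv_mul a)
    have ha2 := congrArg (fun x : S => (x : c.Quotient)) (InverseMonoidWithZero.inv_mul_inv a)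
    have hb1 := congrArg (fun x : S => (x : c.Quotient)) (InverseMonoidWithZero.mul_inv_mul b)
    have hb2 := congrArg (fun x : S => (x : c.Quotient)) (InverseMonoidWithZero.inv_mul_inv b)
    simp only [Con.coe_mul] at ha1 ha2 hb1 hb2
    rw [← hab'] at hb1 hb2
    exact inverse_unique (con_idem_comm c) ha1 ha2 hb1 hb2)
  mul_inv_mul := by
    intro a
    induction a using Con.induction_on with
    | H a =>
      exact congrArg (fun x : S => (x : c.Quotient)) (InverseMonoidWithZero.mul_inv_mul a)
  inv_mul_inv := by
    intro a
    induction a using Con.induction_on with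
    | H a =>
      exact congrArg (fun x : S => (x : c.Quotient)) (InverseMonoidWithZero.inv_mul_inv a)
  inv_unique := by
    intro a b h1 h2
    induction a using Con.induction_on with
    | H a =>
      exact inverse_unique (con_idem_comm c) h1 h2
        (congrArg (fun x : S => (x : c.Quotient)) (InverseMonoidWithZero.mul_inv_mul a))
        (congrArg (fun x : S => (x : c.Quotient)) (InverseMonoidWithZero.inv_mul_inv a))

end InverseMonoid

/-! ## Categories as monoids with many identities

A category `C` is identified with the set `Arrow C` of its arrows, and its identities with its
objects. For an arrow `a`, the domain `d(a)` is `a.left` and the codomain `r(a)` is `a.right`.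
The product `ab` is the composite "first `b`, then `a`". -/

open CategoryTheory

section Categories

variable {C : Type u} [Category.{v} C]

/-- `IsProd a b c`: the product `ab` is defined, that is `d(a) = r(b)`, and is equal to `c`. -/
def IsProd (a b c : Arrow C) : Prop :=
  ∃ h : b.right = a.left, c = Arrow.mk (b.hom ≫ eqToHom h ≫ a.hom)

/-- The right ideal `XC` generated by a set `X` of arrows. -/
def rightIdeal (X : Set (Arrow C)) : Set (Arrow C) :=
  {c | ∃ a ∈ X, ∃ s : Arrow C, IsProd a s c}

/-- Finitely generated right ideals; the empty one is allowed. -/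
def IsFG (R : Set (Arrow C)) : Prop := ∃ X : Set (Arrow C), X.Finite ∧ R = rightIdeal X

/-- `a` and `b` are dependent: `aC ∩ bC ≠ ∅`. -/
def Dependent (a b : Arrow C) : Prop := (rightIdeal {a} ∩ rightIdeal {b}).Nonempty

/-- A code: a finite set of arrows any two distinct elements of which are independent. -/
def IsCode (X : Set (Arrow C)) : Prop :=
  X.Finite ∧ ∀ a ∈ X, ∀ b ∈ X, a ≠ b → ¬ Dependent a b

/-- `X` is large in `aC`. -/
def IsLargeIn (X : Set (Arrow C)) (a : Arrow C) : Prop :=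
  X ⊆ rightIdeal {a} ∧ ∀ b ∈ rightIdeal {a}, ∃ x ∈ X, Dependent b x

variable (C) in
/-- `C` is finitely aligned: every `xC ∩ yC` is finitely generated. -/
class FinitelyAligned : Prop where
  fg_inter : ∀ x y : Arrow C, IsFG (rightIdeal {x} ∩ rightIdeal {y})

variable (C) in
/-- `C` is strongly finitely aligned: every non-empty `xC ∩ yC` is generated by a code. -/
class StronglyFinitelyAligned : Prop where
  code_inter : ∀ x y : Arrow C, (rightIdeal {x} ∩ rightIdeal {y}).Nonempty →
    ∃ X : Set (Arrow C), IsCode X ∧ rightIdeal {x} ∩ rightIdeal {y} = rightIdeal X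

variable (C) in
/-- `C` is cofinal: for all identities `e` and `f` there is a finite large subset `X ⊆ fC` such
that `eCd(x)`, the set of arrows from `d(x)` to `e`, is non-empty for all `x ∈ X`. -/
def IsCofinal : Prop :=
  ∀ e f : C, ∃ X : Set (Arrow C), X.Finite ∧ IsLargeIn X (Arrow.mk (𝟙 f)) ∧
    ∀ x ∈ X, Nonempty (x.left ⟶ e)

theorem IsProd.unique {a b c c' : Arrow C} (h : IsProd a b c) (h' : IsProd a b c') : c = c' := by
  obtain ⟨_, rfl⟩ := h
  obtain ⟨_, rfl⟩ := h'
  rfl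

theorem isProd_id (a : Arrow C) : IsProd a (Arrow.mk (𝟙 a.left)) a :=
  ⟨rfl, by simp⟩

theorem IsProd.left_eq {a b c : Arrow C} (h : IsProd a b c) : b.right = a.left := h.1

theorem exists_isProd {a b : Arrow C} (h : b.right = a.left) : ∃ c, IsProd a b c := ⟨_, h, rfl⟩

theorem IsProd.dom_eq {a b c : Arrow C} (h : IsProd a b c) : c.left = b.left := by
  obtain ⟨_, rfl⟩ := h
  rfl

theorem IsProd.cod_eq {a b c : Arrow C} (h : IsProd a b c) : c.right = a.right := by
  obtain ⟨_, rfl⟩ := h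
  rfl

/-- Associativity. -/
theorem IsProd.assoc {a b c ab abc : Arrow C} (h1 : IsProd a b ab) (h2 : IsProd ab c abc) :
    ∃ bc, IsProd b c bc ∧ IsProd a bc abc := by
  obtain ⟨h, rfl⟩ := h1
  obtain ⟨h', rfl⟩ := h2
  exact ⟨_, ⟨h', rfl⟩, ⟨h, by simp⟩⟩

theorem mem_rightIdeal_self {X : Set (Arrow C)} {a : Arrow C} (h : a ∈ X) : a ∈ rightIdeal X :=
  ⟨a, h, _, isProd_id a⟩

theorem rightIdeal_mul {X : Set (Arrow C)} {a s c : Arrow C} (h : a ∈ rightIdeal X)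
    (hc : IsProd a s c) : c ∈ rightIdeal X := by
  obtain ⟨x, hx, t, ht⟩ := h
  obtain ⟨ts, _, h2⟩ := ht.assoc hc
  exact ⟨x, hx, ts, h2⟩

theorem isFG_inter [FinitelyAligned C] {R R' : Set (Arrow C)} (h : IsFG R) (h' : IsFG R') :
    IsFG (R ∩ R') := by
  obtain ⟨X, hX, rfl⟩ := h
  obtain ⟨Y, hY, rfl⟩ := h'
  choose Z hZ hZ' using fun p : Arrow C × Arrow C => FinitelyAligned.fg_inter p.1 p.2
  refine ⟨⋃ p ∈ X ×ˢ Y, Z p, (hX.prod hY).biUnion fun p _ => hZ p, ?_⟩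
  ext c
  constructor
  · rintro ⟨⟨x, hx, s, hs⟩, ⟨y, hy, t, ht⟩⟩
    have hc : c ∈ rightIdeal {x} ∩ rightIdeal {y} := ⟨⟨x, rfl, s, hs⟩, ⟨y, rfl, t, ht⟩⟩
    rw [hZ' (x, y)] at hc
    obtain ⟨z, hz, w, hw⟩ := hc
    exact ⟨z, Set.mem_biUnion (show (x, y) ∈ X ×ˢ Y from ⟨hx, hy⟩) hz, w, hw⟩
  · rintro ⟨z, hz, w, hw⟩
    obtain ⟨p, hp, hzp⟩ := Set.mem_iUnion₂.1 hz
    have hc : c ∈ rightIdeal {p.1} ∩ rightIdeal {p.2} := by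
      rw [hZ' p]
      exact ⟨z, hzp, w, hw⟩
    obtain ⟨⟨x, hx, s, hs⟩, ⟨y, hy, t, ht⟩⟩ := hc
    rw [Set.mem_singleton_iff] at hx hy
    subst hx hy
    exact ⟨⟨_, hp.1, s, hs⟩, ⟨_, hp.2, t, ht⟩⟩

instance (priority := 100) StronglyFinitelyAligned.finitelyAligned [StronglyFinitelyAligned C] :
    FinitelyAligned C where
  fg_inter := by
    intro x y
    by_cases h : (rightIdeal {x} ∩ rightIdeal {y}).Nonempty
    · obtain ⟨X, hX, h'⟩ := StronglyFinitelyAligned.code_inter x y h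
      exact ⟨X, hX.1, h'⟩
    · refine ⟨∅, Set.finite_empty, ?_⟩
      rw [Set.not_nonempty_iff_eq_empty.1 h]
      ext c
      simp [rightIdeal]

/-! ## The inverse monoids `R(C)` and `B(C)` -/

variable (C) in
/-- The elements of `R(C)`: the bijective morphisms between finitely generated right ideals,
as partial bijections of the set of arrows. -/
structure R where
  toPEquiv : Arrow C ≃. Arrow C
  fg_dom : IsFG {a | ∃ b, b ∈ toPEquiv a}
  fg_ran : IsFG {b | ∃ a, b ∈ toPEquiv a}
  /-- if `θ(a)` and `as` are defined then `θ(as)` and `θ(a)s` are defined and equal. -/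
  map_prod : ∀ a b s c : Arrow C, b ∈ toPEquiv a → IsProd a s c →
    ∃ d, d ∈ toPEquiv c ∧ IsProd b s d

namespace R

theorem ext {s t : R C} (h : s.toPEquiv = t.toPEquiv) : s = t := by
  cases s
  cases t
  cases h
  rfl

theorem dom_eq (θ : R C) {a b : Arrow C} (h : b ∈ θ.toPEquiv a) : b.left = a.left := by
  obtain ⟨d, _, h2⟩ := θ.map_prod a b _ a h (isProd_id a)
  exact h2.left_eq.symm

/-- The inverse of a bijective morphism. -/
def symm (θ : R C) : R C where
  toPEquiv := θ.toPEquiv.symm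
  fg_dom := by
    simpa only [PEquiv.mem_iff_mem] using θ.fg_ran
  fg_ran := by
    simpa only [PEquiv.mem_iff_mem] using θ.fg_dom
  map_prod := by
    intro b a s d hab hd
    rw [PEquiv.mem_iff_mem] at hab
    obtain ⟨c, hc⟩ := exists_isProd (hd.left_eq.trans (θ.dom_eq hab))
    obtain ⟨d', h1, h2⟩ := θ.map_prod a b s c hab hc
    obtain rfl := hd.unique h2
    exact ⟨c, (PEquiv.mem_iff_mem _).2 h1, hc⟩

/-- A bijective morphism maps finitely generated right ideals to such. -/
theorem isFG_image (θ : R C) {Q : Set (Arrow C)} (hQ : IsFG Q)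
    (hsub : Q ⊆ {a | ∃ b, b ∈ θ.toPEquiv a}) :
    IsFG {b | ∃ a ∈ Q, b ∈ θ.toPEquiv a} := by
  obtain ⟨X, hX, rfl⟩ := hQ
  refine ⟨{b | ∃ a ∈ X, b ∈ θ.toPEquiv a}, ?_, ?_⟩
  · refine ((hX.image fun a => θ.toPEquiv a).preimage
      (Function.Injective.injOn (Option.some_injective _))).subset ?_
    rintro b ⟨a, ha, hb⟩
    exact ⟨a, ha, hb⟩
  · ext b
    constructor
    · rintro ⟨c, ⟨a, ha, s, hs⟩, hb⟩
      obtain ⟨a', ha'⟩ := hsub (mem_rightIdeal_self ha)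
      obtain ⟨d, h1, h2⟩ := θ.map_prod a a' s c ha' hs
      obtain rfl := Option.mem_unique hb h1
      exact ⟨a', ⟨a, ha, ha'⟩, s, h2⟩
    · rintro ⟨a', ⟨a, ha, ha'⟩, s, hs⟩
      obtain ⟨c, hc⟩ := exists_isProd (hs.left_eq.trans (θ.dom_eq ha'))
      obtain ⟨d, h1, h2⟩ := θ.map_prod a a' s c ha' hc
      obtain rfl := hs.unique h2
      exact ⟨c, ⟨a, ha, s, hc⟩, h1⟩

theorem isFG_dom_trans [FinitelyAligned C] (s t : R C) :
    IsFG {a | ∃ b, b ∈ t.toPEquiv.trans s.toPEquiv a} := by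
  have h := t.symm.isFG_image (isFG_inter t.fg_ran s.fg_dom) (by
    rintro b ⟨⟨a, ha⟩, _⟩
    exact ⟨a, (PEquiv.mem_iff_mem _).2 ha⟩)
  convert h using 1
  ext a
  constructor
  · rintro ⟨c, hac⟩
    obtain ⟨b, hb, hc⟩ := (PEquiv.mem_trans _ _ _ _).1 hac
    exact ⟨b, ⟨⟨a, hb⟩, c, hc⟩, (PEquiv.mem_iff_mem _).2 hb⟩
  · rintro ⟨b, ⟨_, c, hc⟩, hb⟩
    exact ⟨c, (PEquiv.mem_trans _ _ _ _).2 ⟨b, (PEquiv.mem_iff_mem _).1 hb, hc⟩⟩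

/-- The composite `st`: first `t`, then `s`, where defined. -/
def comp [FinitelyAligned C] (s t : R C) : R C where
  toPEquiv := t.toPEquiv.trans s.toPEquiv
  fg_dom := isFG_dom_trans s t
  fg_ran := by
    have h := isFG_dom_trans t.symm s.symm
    change IsFG {a | ∃ b, b ∈ (s.toPEquiv.symm.trans t.toPEquiv.symm) a} at h
    rw [← PEquiv.symm_trans_rev] at h
    simpa only [PEquiv.mem_iff_mem] using h
  map_prod := by
    intro a c x ax hac hax
    obtain ⟨b, hb, hc⟩ := (PEquiv.mem_trans _ _ _ _).1 hac
    obtain ⟨d, hd, hbd⟩ := t.map_prod a b x ax hb hax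
    obtain ⟨d', hd', hcd⟩ := s.map_prod b c x d hc hbd
    exact ⟨d', (PEquiv.mem_trans _ _ _ _).2 ⟨d, hd, hd'⟩, hcd⟩

/-- The identity function on `C`. -/
def one [Finite C] : R C where
  toPEquiv := PEquiv.refl _
  fg_dom := by
    refine ⟨Set.range fun e : C => Arrow.mk (𝟙 e), Set.finite_range _, ?_⟩
    ext a
    exact ⟨fun _ => ⟨_, ⟨a.right, rfl⟩, a, rfl, by simp⟩, fun _ => ⟨a, rfl⟩⟩
  fg_ran := by
    refine ⟨Set.range fun e : C => Arrow.mk (𝟙 e), Set.finite_range _, ?_⟩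
    ext a
    exact ⟨fun _ => ⟨_, ⟨a.right, rfl⟩, a, rfl, by simp⟩, fun _ => ⟨a, rfl⟩⟩
  map_prod := by
    intro a b s c hab hc
    simp only [PEquiv.refl_apply, Option.mem_def, Option.some.injEq] at hab
    subst hab
    exact ⟨c, rfl, hc⟩

/-- The empty function. -/
def zero : R C where
  toPEquiv := ⊥
  fg_dom := ⟨∅, Set.finite_empty, by ext c; simp [rightIdeal]⟩
  fg_ran := ⟨∅, Set.finite_empty, by ext c; simp [rightIdeal]⟩
  map_prod := by
    intro a b s c hab
    simp at hab

instance [FinitelyAligned C] [Finite C] : InverseMonoidWithZero (R C) where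
  mul := comp
  mul_assoc _ _ _ := ext (PEquiv.trans_assoc _ _ _).symm
  one := one
  one_mul _ := ext (PEquiv.trans_refl _)
  mul_one _ := ext (PEquiv.refl_trans _)
  zero := zero
  zero_mul _ := ext (PEquiv.trans_bot _)
  mul_zero _ := ext (PEquiv.bot_trans _)
  inv := symm
  mul_inv_mul s := ext <| by
    change s.toPEquiv.trans (s.toPEquiv.symm.trans s.toPEquiv) = s.toPEquiv
    ext a b
    simp only [← Option.mem_def, PEquiv.mem_trans, PEquiv.mem_iff_mem]
    constructor
    · rintro ⟨c, hc, d, hd, hb⟩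
      obtain rfl := s.toPEquiv.inj hc hd
      exact hb
    · intro h
      exact ⟨b, h, a, h, h⟩
  inv_mul_inv s := ext <| by
    change s.toPEquiv.symm.trans (s.toPEquiv.trans s.toPEquiv.symm) = s.toPEquiv.symm
    ext a b
    simp only [← Option.mem_def, PEquiv.mem_trans, PEquiv.mem_iff_mem]
    constructor
    · rintro ⟨c, hc, d, hd, hb⟩
      obtain rfl := Option.mem_unique hc hd
      exact hb
    · intro h
      exact ⟨b, h, a, h, h⟩
  inv_unique s t h1 h2 := ext <| by
    have h1' : s.toPEquiv.trans (t.toPEquiv.trans s.toPEquiv) = s.toPEquiv :=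
      congrArg toPEquiv h1
    have h2' : t.toPEquiv.trans (s.toPEquiv.trans t.toPEquiv) = t.toPEquiv :=
      congrArg toPEquiv h2
    change t.toPEquiv = s.toPEquiv.symm
    ext a b
    rw [← Option.mem_def, ← Option.mem_def, PEquiv.mem_iff_mem]
    constructor
    · intro h
      have h' := h
      rw [← h2', PEquiv.mem_trans] at h'
      obtain ⟨c, hc, hd⟩ := h'
      obtain ⟨d, hd, hb⟩ := (PEquiv.mem_trans _ _ _ _).1 hd
      obtain rfl := Option.mem_unique h hc
      obtain rfl := t.toPEquiv.inj h hb
      exact hd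
    · intro h
      have h' := h
      rw [← h1', PEquiv.mem_trans] at h'
      obtain ⟨c, hc, hd⟩ := h'
      obtain ⟨d, hd, hb⟩ := (PEquiv.mem_trans _ _ _ _).1 hd
      obtain rfl := Option.mem_unique h hc
      obtain rfl := s.toPEquiv.inj h hb
      exact hd

end R

variable (C) in
/-- `B(C) = R(C)/≡`. -/
abbrev B [FinitelyAligned C] [Finite C] := (lenzCon (R C)).Quotient

/-! ## Higher rank graphs -/

/-- The structure of a `k`-graph on a category `C`: `C` is countable and there is a degree functor
to `ℕᵏ` with the unique factorization property. -/
structure KGraph (k : ℕ) (C : Type u) [Category.{v} C] where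
  countable_arrow : Countable (Arrow C)
  degree : Arrow C → (Fin k → ℕ)
  degree_id : ∀ e : C, degree (Arrow.mk (𝟙 e)) = 0
  degree_prod : ∀ a b c : Arrow C, IsProd a b c → degree c = degree a + degree b
  factorization : ∀ (a : Arrow C) (m n : Fin k → ℕ), degree a = m + n →
    ∃! p : Arrow C × Arrow C, IsProd p.1 p.2 a ∧ degree p.1 = m ∧ degree p.2 = n

namespace KGraph

variable {k : ℕ}

/-- No sources: for every identity `e` and every `m` there is an arrow with range `e` and
degree `m`. -/
def NoSources (G : KGraph k C) : Prop :=
  ∀ (e : C) (m : Fin k → ℕ), ∃ x : Arrow C, x.right = e ∧ G.degree x = m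

/-- Row finite: for every identity `e` and every `m` there are only finitely many arrows with
range `e` and degree `m`. -/
def RowFinite (G : KGraph k C) : Prop :=
  ∀ (e : C) (m : Fin k → ℕ), {x : Arrow C | x.right = e ∧ G.degree x = m}.Finite

end KGraph

end Categories

end HigherRank

namespace HigherRank

open CategoryTheory

/-! ### Ideals and idempotents of inverse monoids with zero -/

section InverseMonoid

variable {S : Type*} [InverseMonoidWithZero S]

/-! View an element of R(C) through its graph. The natural order becomes inclusion of graphs
(`natLE_iff`), and s ≡ t means that s and t eventually agree: whenever one of them sends a to b,
some w makes the other send aw to bw (`lenzRel_iff`). One half of this condition describes the order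
of B(C) (`natLE_toB_iff`). Unique factorization makes C cancellative, so an element that is
idempotent modulo ≡ is already a partial identity. Hence any representatives of compatible classes
have a union in R(C), and it represents their join (`exists_isJoin`).

Cofinal implies 0-simplifying: a non-zero additive ideal contains the class of the identity on some
aC. An arrow u from d(x) to d(a) gives au ∈ aC with the same domain as x, and conjugating by the
translation auC → xC puts the class of the identity on xC in the ideal. Cofinality for d(a) and
every f supplies finitely many such x, large in all of C; the join of their identities is 1.

0-simplifying implies cofinal: the classes having a representative s such that every arrow in the
domain of s starts at an object with an arrow to e form a non-zero additive ideal
(`isAdditiveIdeal_reachIdeal`), so 1 ≡ s for such an s. The generators of the domain of s with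
codomain f are the required large set. -/

theorem IsSemigroupIdeal.zero_mem {I : Set S} (hI : IsSemigroupIdeal I) : (0 : S) ∈ I := by
  obtain ⟨a, ha⟩ := hI.1
  simpa using (hI.2 a ha 0).1

theorem IsSemigroupIdeal.mem_of_natLE {I : Set S} (hI : IsSemigroupIdeal I) {a b : S}
    (h : NatLE a b) (hb : b ∈ I) : a ∈ I := by
  rw [show a = b * (a⁻¹ * a) from h]
  exact (hI.2 b hb _).2

theorem inv_eq_self_of_idem {e : S} (he : e * e = e) : e⁻¹ = e :=
  (InverseMonoidWithZero.inv_unique e e (by rw [he, he]) (by rw [he, he])).symm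

theorem compatible_of_idem {e f : S} (he : e * e = e) (hf : f * f = f) : Compatible e f := by
  unfold Compatible
  rw [inv_eq_self_of_idem he, inv_eq_self_of_idem hf]
  exact ⟨idem_mul_idem he hf, idem_mul_idem he hf⟩

end InverseMonoid

section Categories

variable {C : Type u} [Category.{v} C]

/-! ### Finitely generated right ideals and cancellation in k-graphs -/

theorem rightIdeal_union (X Y : Set (Arrow C)) :
    rightIdeal (X ∪ Y) = rightIdeal X ∪ rightIdeal Y := by
  ext c
  constructor
  · rintro ⟨a, ha | ha, s, hs⟩
    exacts [Or.inl ⟨a, ha, s, hs⟩, Or.inr ⟨a, ha, s, hs⟩]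
  · rintro (⟨a, ha, s, hs⟩ | ⟨a, ha, s, hs⟩)
    exacts [⟨a, Or.inl ha, s, hs⟩, ⟨a, Or.inr ha, s, hs⟩]

theorem isFG_union {P Q : Set (Arrow C)} (hP : IsFG P) (hQ : IsFG Q) : IsFG (P ∪ Q) := by
  obtain ⟨X, hX, rfl⟩ := hP
  obtain ⟨Y, hY, rfl⟩ := hQ
  exact ⟨X ∪ Y, hX.union hY, (rightIdeal_union X Y).symm⟩

theorem IsFG.mul_mem {P : Set (Arrow C)} (hP : IsFG P) {a s c : Arrow C} (ha : a ∈ P)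
    (hc : IsProd a s c) : c ∈ P := by
  obtain ⟨X, _, rfl⟩ := hP
  exact rightIdeal_mul ha hc

theorem mem_rightIdeal_singleton {a c : Arrow C} :
    c ∈ rightIdeal {a} ↔ ∃ s, IsProd a s c := by
  simp [rightIdeal]

theorem dependent_iff {a b : Arrow C} :
    Dependent a b ↔ ∃ s t c, IsProd a s c ∧ IsProd b t c := by
  constructor
  · rintro ⟨c, h1, h2⟩
    obtain ⟨s, hs⟩ := mem_rightIdeal_singleton.1 h1
    obtain ⟨t, ht⟩ := mem_rightIdeal_singleton.1 h2
    exact ⟨s, t, c, hs, ht⟩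
  · rintro ⟨s, t, c, hs, ht⟩
    exact ⟨c, mem_rightIdeal_singleton.2 ⟨s, hs⟩, mem_rightIdeal_singleton.2 ⟨t, ht⟩⟩

theorem mem_rightIdeal_id {f : C} {b : Arrow C} :
    b ∈ rightIdeal {Arrow.mk (𝟙 f)} ↔ b.right = f := by
  rw [mem_rightIdeal_singleton]
  constructor
  · rintro ⟨s, hs⟩
    exact hs.cod_eq
  · intro h
    subst h
    exact ⟨b, rfl, by simp⟩

namespace KGraph

variable {k : ℕ} (G : KGraph k C)

include G in
-- Additivity of the degree forces b and b' to have equal degrees, so both products are the same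
-- factorization of c.
theorem mul_left_cancel {a b b' c : Arrow C} (h : IsProd a b c) (h' : IsProd a b' c) :
    b = b' := by
  have hd := G.degree_prod _ _ _ h
  have hd' : G.degree b = G.degree b' :=
    add_left_cancel (hd.symm.trans (G.degree_prod _ _ _ h'))
  exact congrArg Prod.snd
    ((G.factorization c _ _ hd).unique (y₁ := (a, b)) (y₂ := (a, b')) ⟨h, rfl, rfl⟩
      ⟨h', rfl, hd'.symm⟩)

include G in
theorem mul_right_cancel {a a' b c : Arrow C} (h : IsProd a b c) (h' : IsProd a' b c) :
    a = a' := by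
  have hd := G.degree_prod _ _ _ h
  have hd' : G.degree a = G.degree a' :=
    add_right_cancel (hd.symm.trans (G.degree_prod _ _ _ h'))
  exact congrArg Prod.fst
    ((G.factorization c _ _ hd).unique (y₁ := (a, b)) (y₂ := (a', b)) ⟨h, rfl, rfl⟩
      ⟨h', hd'.symm, rfl⟩)

end KGraph

/-! ### Elements of R(C) built from their graphs -/

/-- The partial bijection whose graph is a given bi-unique relation. -/
noncomputable def pequivOfRel {α β : Type*} (r : α → β → Prop)
    (hfun : ∀ a b b', r a b → r a b' → b = b') (hinj : ∀ a a' b, r a b → r a' b → a = a') :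
    α ≃. β :=
  open scoped Classical in
  { toFun := fun a => if h : ∃ b, r a b then some h.choose else none
    invFun := fun b => if h : ∃ a, r a b then some h.choose else none
    inv := by
      intro a b
      constructor
      · intro h
        split_ifs at h with h1
        · obtain rfl : h1.choose = a := by simpa using h
          have h2 : ∃ b', r h1.choose b' := ⟨b, h1.choose_spec⟩
          rw [dif_pos h2]
          exact congrArg some (hfun _ _ _ h2.choose_spec h1.choose_spec)
      · intro h
        split_ifs at h with h1
        · obtain rfl : h1.choose = b := by simpa using h
          have h2 : ∃ a', r a' h1.choose := ⟨a, h1.choose_spec⟩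
          rw [dif_pos h2]
          exact congrArg some (hinj _ _ _ h2.choose_spec h1.choose_spec) }

theorem mem_pequivOfRel {α β : Type*} {r : α → β → Prop}
    {hfun : ∀ a b b', r a b → r a b' → b = b'} {hinj : ∀ a a' b, r a b → r a' b → a = a'}
    {a : α} {b : β} : b ∈ pequivOfRel r hfun hinj a ↔ r a b := by
  classical
  change b ∈ (if h : ∃ b, r a b then some h.choose else none) ↔ r a b
  split_ifs with h
  · simp only [Option.mem_def, Option.some.injEq]
    constructor
    · rintro rfl
      exact h.choose_spec
    · exact hfun _ _ _ h.choose_spec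
  · simp only [Option.mem_def, reduceCtorEq, false_iff]
    exact fun hb => h ⟨b, hb⟩

namespace R

/-- `s.Maps a b`: the partial bijection `s` maps `a` to `b`. -/
def Maps (s : R C) (a b : Arrow C) : Prop := b ∈ s.toPEquiv a

theorem Maps.unique {s : R C} {a b b' : Arrow C} (h : s.Maps a b) (h' : s.Maps a b') : b = b' :=
  Option.mem_unique h h'

theorem Maps.inj {s : R C} {a a' b : Arrow C} (h : s.Maps a b) (h' : s.Maps a' b) : a = a' :=
  s.toPEquiv.inj h h'

theorem Maps.left_eq {s : R C} {a b : Arrow C} (h : s.Maps a b) : b.left = a.left := s.dom_eq h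

theorem Maps.mul {s : R C} {a b w c d : Arrow C} (h : s.Maps a b) (hc : IsProd a w c)
    (hd : IsProd b w d) : s.Maps c d := by
  obtain ⟨d', h1, h2⟩ := s.map_prod a b w c h hc
  obtain rfl := hd.unique h2
  exact h1

theorem Maps.exists_mul {s : R C} {a b w c : Arrow C} (h : s.Maps a b) (hc : IsProd a w c) :
    ∃ d, s.Maps c d ∧ IsProd b w d := s.map_prod a b w c h hc

theorem ext_maps {s t : R C} (h : ∀ a b, s.Maps a b ↔ t.Maps a b) : s = t :=
  R.ext (PEquiv.ext fun a => Option.ext fun b => h a b)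

/-- The element of `R(C)` with a given graph. -/
noncomputable def ofRel (r : Arrow C → Arrow C → Prop)
    (hfun : ∀ a b b', r a b → r a b' → b = b') (hinj : ∀ a a' b, r a b → r a' b → a = a')
    (hdom : IsFG {a | ∃ b, r a b}) (hran : IsFG {b | ∃ a, r a b})
    (hmul : ∀ a b w c, r a b → IsProd a w c → ∃ d, r c d ∧ IsProd b w d) : R C where
  toPEquiv := pequivOfRel r hfun hinj
  fg_dom := by simpa only [mem_pequivOfRel] using hdom
  fg_ran := by simpa only [mem_pequivOfRel] using hran
  map_prod := by simpa only [mem_pequivOfRel] using hmul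

theorem maps_ofRel {r : Arrow C → Arrow C → Prop} {hfun hinj hdom hran hmul} {a b : Arrow C} :
    (ofRel r hfun hinj hdom hran hmul).Maps a b ↔ r a b :=
  mem_pequivOfRel (hfun := hfun) (hinj := hinj)

/-- The identity function on a finitely generated right ideal. -/
noncomputable def idOn (P : Set (Arrow C)) (hP : IsFG P) : R C :=
  ofRel (fun a b => a ∈ P ∧ b = a) (by rintro a b b' ⟨_, rfl⟩ ⟨_, rfl⟩; rfl)
    (by rintro a a' b ⟨_, rfl⟩ ⟨_, rfl⟩; rfl) (by simpa using hP)
    (by convert hP using 1; ext b; simp)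
    (by rintro a b w c ⟨ha, rfl⟩ hc; exact ⟨c, ⟨hP.mul_mem ha hc, rfl⟩, hc⟩)

theorem maps_idOn {P : Set (Arrow C)} {hP : IsFG P} {a b : Arrow C} :
    (idOn P hP).Maps a b ↔ a ∈ P ∧ b = a := maps_ofRel

theorem isFG_rightIdeal {X : Set (Arrow C)} (hX : X.Finite) : IsFG (rightIdeal X) :=
  ⟨X, hX, rfl⟩

theorem isFG_singleton (x : Arrow C) : IsFG (rightIdeal {x}) :=
  isFG_rightIdeal (Set.finite_singleton x)

/-- In a `k`-graph, the map `xC → yC` with `xw ↦ yw`, for `d(x) = d(y)`. -/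
noncomputable def translate {k : ℕ} (G : KGraph k C) (x y : Arrow C) (h : x.left = y.left) : R C :=
  ofRel (fun a b => ∃ w, IsProd x w a ∧ IsProd y w b)
    (by
      rintro a b b' ⟨w, h1, h2⟩ ⟨w', h1', h2'⟩
      -- Left cancellation makes the map single-valued: a = xw determines w.
      obtain rfl := G.mul_left_cancel h1 h1'
      exact h2.unique h2')
    (by
      rintro a a' b ⟨w, h1, h2⟩ ⟨w', h1', h2'⟩
      obtain rfl := G.mul_left_cancel h2 h2'
      exact h1.unique h1')
    (by
      convert isFG_singleton x using 1
      ext a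
      rw [mem_rightIdeal_singleton]
      constructor
      · rintro ⟨b, w, h1, _⟩
        exact ⟨w, h1⟩
      · rintro ⟨w, h1⟩
        obtain ⟨b, hb⟩ := exists_isProd (h1.left_eq.trans h)
        exact ⟨b, w, h1, hb⟩)
    (by
      convert isFG_singleton y using 1
      ext b
      rw [mem_rightIdeal_singleton]
      constructor
      · rintro ⟨a, w, _, h1⟩
        exact ⟨w, h1⟩
      · rintro ⟨w, h1⟩
        obtain ⟨a, ha⟩ := exists_isProd (h1.left_eq.trans h.symm)
        exact ⟨a, w, ha, h1⟩)
    (by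
      rintro a b w c ⟨u, h1, h2⟩ hc
      -- With a = xu and b = yu, the products aw and bw are x(uw) and y(uw) with a common second
      -- factor.
      obtain ⟨uw, h3, h4⟩ := h1.assoc hc
      obtain ⟨d, hd⟩ := exists_isProd (hc.left_eq.trans (h1.dom_eq.trans h2.dom_eq.symm))
      obtain ⟨uw', h5, h6⟩ := h2.assoc hd
      obtain rfl := h3.unique h5
      exact ⟨d, ⟨uw, h4, h6⟩, hd⟩)

theorem maps_translate {k : ℕ} {G : KGraph k C} {x y : Arrow C} {h : x.left = y.left}
    {a b : Arrow C} : (translate G x y h).Maps a b ↔ ∃ w, IsProd x w a ∧ IsProd y w b :=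
  maps_ofRel

/-- The union of two elements of `R(C)` whose union is a partial bijection. -/
noncomputable def union (s t : R C) (hfun : ∀ a b b', s.Maps a b → t.Maps a b' → b = b')
    (hinj : ∀ a a' b, s.Maps a b → t.Maps a' b → a = a') : R C :=
  ofRel (fun a b => s.Maps a b ∨ t.Maps a b)
    (by
      rintro a b b' (h | h) (h' | h')
      exacts [h.unique h', hfun _ _ _ h h', (hfun _ _ _ h' h).symm, h.unique h'])
    (by
      rintro a a' b (h | h) (h' | h')
      exacts [h.inj h', hinj _ _ _ h h', (hinj _ _ _ h' h).symm, h.inj h'])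
    (by
      convert isFG_union s.fg_dom t.fg_dom using 1
      ext a
      exact exists_or)
    (by
      convert isFG_union s.fg_ran t.fg_ran using 1
      ext a
      exact exists_or)
    (by
      rintro a b w c (h | h) hc
      · obtain ⟨d, h1, h2⟩ := h.exists_mul hc
        exact ⟨d, Or.inl h1, h2⟩
      · obtain ⟨d, h1, h2⟩ := h.exists_mul hc
        exact ⟨d, Or.inr h1, h2⟩)

theorem maps_union {s t : R C} {hfun hinj} {a b : Arrow C} :
    (union s t hfun hinj).Maps a b ↔ s.Maps a b ∨ t.Maps a b := maps_ofRel

/-! ### The operations and the natural order of R(C) through graphs -/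

section Monoid

variable [FinitelyAligned C] [Finite C]

theorem maps_mul {s t : R C} {a b : Arrow C} :
    (s * t).Maps a b ↔ ∃ c, t.Maps a c ∧ s.Maps c b :=
  PEquiv.mem_trans _ _ _ _

theorem maps_inv {s : R C} {a b : Arrow C} : s⁻¹.Maps a b ↔ s.Maps b a :=
  PEquiv.mem_iff_mem _

theorem maps_one {a b : Arrow C} : (1 : R C).Maps a b ↔ b = a := by
  change b ∈ some a ↔ b = a
  simp [eq_comm]

theorem not_maps_zero (a b : Arrow C) : ¬ (0 : R C).Maps a b := by
  change ¬ b ∈ none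
  simp

theorem ne_zero_iff {s : R C} : s ≠ 0 ↔ ∃ a b, s.Maps a b := by
  constructor
  · intro h
    by_contra! h'
    exact h (ext_maps fun a b => iff_of_false (h' a b) (not_maps_zero a b))
  · rintro ⟨a, b, h⟩ rfl
    exact not_maps_zero a b h

/-- `s⁻¹ * s` is the identity on the domain of `s`, so `t * (s⁻¹ * s)` is `t` restricted to that
domain. -/
theorem natLE_iff {s t : R C} : NatLE s t ↔ ∀ a b, s.Maps a b → t.Maps a b := by
  constructor
  · intro h a b hab
    rw [show s = t * (s⁻¹ * s) from h] at hab
    obtain ⟨c, hc, hcb⟩ := maps_mul.1 hab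
    obtain ⟨d, hd, hdc⟩ := maps_mul.1 hc
    obtain rfl := hd.inj (maps_inv.1 hdc)
    exact hcb
  · intro h
    refine ext_maps fun a b => ?_
    rw [maps_mul]
    constructor
    · intro hab
      exact ⟨a, maps_mul.2 ⟨b, hab, maps_inv.2 hab⟩, h _ _ hab⟩
    · rintro ⟨c, hc, hcb⟩
      obtain ⟨d, hd, hdc⟩ := maps_mul.1 hc
      obtain rfl := hd.inj (maps_inv.1 hdc)
      obtain rfl := (h _ _ hd).unique hcb
      exact hd

/-! ### The congruence ≡ and the order of B(C) -/

/-- Wherever `s` is defined, it agrees with `t` after some extension of the argument. -/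
def EventuallyLE (s t : R C) : Prop :=
  ∀ a b, s.Maps a b → ∃ w c d, IsProd a w c ∧ IsProd b w d ∧ t.Maps c d

/-- A non-zero element always has a non-zero restriction to some principal right ideal, so it
suffices to test ≡ on those; this replaces quantifiers over R(C) by quantifiers over arrows. -/
theorem eventuallyLE_iff {s t : R C} : EventuallyLE s t ↔
    ∀ x : R C, x ≠ 0 → NatLE x s → ∃ z : R C, z ≠ 0 ∧ NatLE z x ∧ NatLE z t := by
  constructor
  · intro h x hx hxs
    obtain ⟨a, b, hab⟩ := ne_zero_iff.1 hx
    obtain ⟨w, c, d, hc, hd, hcd⟩ := h a b (natLE_iff.1 hxs a b hab)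
    have hx' := hab.mul hc hd
    -- Both `x` and `t` send `c` to `d`, so they agree on all of cC; their common restriction to cC
    -- is the witness.
    refine ⟨x * idOn (rightIdeal {c}) (isFG_singleton c), ?_, ?_, ?_⟩
    · exact ne_zero_iff.2 ⟨c, d, maps_mul.2 ⟨c, maps_idOn.2 ⟨mem_rightIdeal_self rfl, rfl⟩, hx'⟩⟩
    · refine natLE_iff.2 fun p q hpq => ?_
      obtain ⟨p', hp, hq⟩ := maps_mul.1 hpq
      obtain ⟨_, rfl⟩ := maps_idOn.1 hp
      exact hq
    · refine natLE_iff.2 fun p q hpq => ?_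
      obtain ⟨p', hp, hq⟩ := maps_mul.1 hpq
      obtain ⟨hpc, rfl⟩ := maps_idOn.1 hp
      obtain ⟨u, hu⟩ := mem_rightIdeal_singleton.1 hpc
      obtain ⟨q', h1, h2⟩ := hx'.exists_mul hu
      obtain rfl := hq.unique h1
      exact hcd.mul hu h2
  · intro h a b hab
    have hda := mem_rightIdeal_self (Set.mem_singleton a)
    -- The hypothesis is applied to `s` restricted to aC, so any argument of `z` has the form aw.
    obtain ⟨z, hz, hzx, hzt⟩ := h (s * idOn (rightIdeal {a}) (isFG_singleton a))
      (ne_zero_iff.2 ⟨a, b, maps_mul.2 ⟨a, maps_idOn.2 ⟨hda, rfl⟩, hab⟩⟩)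
      (natLE_iff.2 fun p q hpq => by
        obtain ⟨p', hp, hq⟩ := maps_mul.1 hpq
        obtain ⟨_, rfl⟩ := maps_idOn.1 hp
        exact hq)
    obtain ⟨c, d, hcd⟩ := ne_zero_iff.1 hz
    obtain ⟨c', hc, hd⟩ := maps_mul.1 (natLE_iff.1 hzx _ _ hcd)
    obtain ⟨hca, rfl⟩ := maps_idOn.1 hc
    obtain ⟨w, hw⟩ := mem_rightIdeal_singleton.1 hca
    obtain ⟨d', h1, h2⟩ := hab.exists_mul hw
    obtain rfl := hd.unique h1
    exact ⟨w, _, _, hw, h2, natLE_iff.1 hzt _ _ hcd⟩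

theorem lenzRel_iff {s t : R C} : LenzRel s t ↔ EventuallyLE s t ∧ EventuallyLE t s :=
  and_congr eventuallyLE_iff.symm eventuallyLE_iff.symm

theorem eventuallyLE_of_natLE {s t : R C} (h : NatLE s t) : EventuallyLE s t :=
  fun a b hab => ⟨_, a, b, isProd_id a, by rw [← hab.left_eq]; exact isProd_id b,
    natLE_iff.1 h a b hab⟩

/-- The class in `B(C)` of an element of `R(C)`. -/
def toB (s : R C) : B C := (s : (lenzCon (R C)).Quotient)

theorem toB_surjective (q : B C) : ∃ s : R C, toB s = q := by
  induction q using Con.induction_on with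
  | H s => exact ⟨s, rfl⟩

theorem toB_mul (s t : R C) : toB (s * t) = toB s * toB t := rfl

theorem toB_zero : toB (0 : R C) = 0 := rfl

theorem toB_one : toB (1 : R C) = 1 := rfl

theorem toB_eq_iff {s t : R C} : toB s = toB t ↔ EventuallyLE s t ∧ EventuallyLE t s :=
  (Con.eq (lenzCon (R C))).trans lenzRel_iff

theorem toB_eq_zero_iff {s : R C} : toB s = 0 ↔ s = 0 := by
  constructor
  · intro h
    rw [← toB_zero] at h
    by_contra h0
    obtain ⟨a, b, hab⟩ := ne_zero_iff.1 h0
    obtain ⟨w, c, d, -, -, hcd⟩ := (toB_eq_iff.1 h).1 a b hab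
    exact not_maps_zero c d hcd
  · rintro rfl
    rfl

/-- The natural order of B(C) unfolds to s ≡ t s⁻¹ s. Where t s⁻¹ s is defined, so is s, and hence
the second half of ≡ follows from the first. -/
theorem natLE_toB_iff {s t : R C} : NatLE (toB s) (toB t) ↔ EventuallyLE s t := by
  change toB s = toB (t * (s⁻¹ * s)) ↔ _
  rw [toB_eq_iff]
  constructor
  · rintro ⟨h, -⟩ a b hab
    obtain ⟨w, c, d, hc, hd, hcd⟩ := h a b hab
    obtain ⟨c', hc', hd'⟩ := maps_mul.1 hcd
    obtain ⟨p, hp, hpc⟩ := maps_mul.1 hc'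
    obtain rfl := hp.inj (maps_inv.1 hpc)
    exact ⟨w, c, d, hc, hd, hd'⟩
  · intro h
    constructor
    · intro a b hab
      obtain ⟨w, c, d, hc, hd, hcd⟩ := h a b hab
      have hs := hab.mul hc hd
      exact ⟨w, c, d, hc, hd, maps_mul.2 ⟨c, maps_mul.2 ⟨d, hs, maps_inv.2 hs⟩, hcd⟩⟩
    · intro a b hab
      obtain ⟨a', ha', hb⟩ := maps_mul.1 hab
      obtain ⟨p, hp, hpa⟩ := maps_mul.1 ha'
      obtain rfl := hp.inj (maps_inv.1 hpa)
      obtain ⟨w, c, d, hc, hd, hcd⟩ := h a p hp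
      obtain ⟨d', h1, h2⟩ := hb.exists_mul hc
      obtain rfl := hcd.unique h1
      exact ⟨w, c, d, hc, h2, hp.mul hc hd⟩

/-- The union is least because `EventuallyLE` is tested one pair of the graph at a time. -/
theorem isJoin_union {s t : R C} {hfun hinj} :
    IsJoin (toB s) (toB t) (toB (union s t hfun hinj)) := by
  refine ⟨natLE_toB_iff.2 (eventuallyLE_of_natLE (natLE_iff.2 fun a b h => maps_union.2 (Or.inl h))),
    natLE_toB_iff.2 (eventuallyLE_of_natLE (natLE_iff.2 fun a b h => maps_union.2 (Or.inr h))), ?_⟩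
  intro q h1 h2
  obtain ⟨c, rfl⟩ := toB_surjective q
  rw [natLE_toB_iff] at *
  intro a b hab
  exact (maps_union.1 hab).elim (h1 a b) (h2 a b)

/-! ### Compatible classes and their joins -/

variable {k : ℕ} (G : KGraph k C)

include G in
/-- An element of `R(C)` that is idempotent modulo `≡` is a partial identity. -/
theorem eq_of_isIdempotentElem_toB {u : R C} (h : IsIdempotentElem (toB u)) {a b : Arrow C}
    (hab : u.Maps a b) : a = b := by
  obtain ⟨w, c, d, hc, hd, hcd⟩ := (toB_eq_iff.1 (show toB (u * u) = toB u from h)).2 a b hab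
  -- `u` and `u * u` both send c = aw to d = bw. So `u` sends d to d as well as c to d, injectivity
  -- gives c = d, and cancelling w on the right gives a = b.
  obtain ⟨p, hp, hpd⟩ := maps_mul.1 hcd
  have hs := hab.mul hc hd
  obtain rfl := hs.unique hp
  obtain rfl := hs.inj hpd
  exact G.mul_right_cancel hc hd

include G in
-- Compatibility in B(C) makes `s⁻¹ * t` and `s * t⁻¹` partial identities in R(C), which says that
-- the union of `s` and `t` is injective and single-valued. The second conjunct lets properties of
-- the domains pass to the join.
theorem exists_isJoin {s t : R C} (h : Compatible (toB s) (toB t)) :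
    ∃ c : R C, IsJoin (toB s) (toB t) (toB c) ∧
      ∀ a b, c.Maps a b → s.Maps a b ∨ t.Maps a b := by
  have hinj : ∀ a a' b, s.Maps a b → t.Maps a' b → a = a' := fun a a' b h1 h2 =>
    (eq_of_isIdempotentElem_toB G (u := s⁻¹ * t) h.1
      (maps_mul.2 ⟨b, h2, maps_inv.2 h1⟩)).symm
  have hfun : ∀ a b b', s.Maps a b → t.Maps a b' → b = b' := fun a b b' h1 h2 =>
    (eq_of_isIdempotentElem_toB G (u := s * t⁻¹) h.2
      (maps_mul.2 ⟨a, maps_inv.2 h2, h1⟩)).symm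
  exact ⟨union s t hfun hinj, isJoin_union, fun a b => maps_union.1⟩

/-! ### Identities on right ideals; cofinal implies 0-simplifying -/

theorem idOn_mul_idOn {P Q : Set (Arrow C)} (hP : IsFG P) (hQ : IsFG Q) (h : P ⊆ Q) :
    idOn P hP * idOn Q hQ = idOn P hP := by
  refine ext_maps fun a b => ?_
  simp only [maps_mul, maps_idOn]
  constructor
  · rintro ⟨c, ⟨_, rfl⟩, h2⟩
    exact h2
  · rintro ⟨h1, rfl⟩
    exact ⟨b, ⟨h h1, rfl⟩, h1, rfl⟩

/-- This carries membership in an ideal from the identity on xC to that on yC whenever x and y have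
equal domains. -/
theorem translate_mul_idOn_mul {x y : Arrow C} (h : x.left = y.left) :
    translate G x y h * idOn (rightIdeal {x}) (isFG_singleton x) * translate G y x h.symm =
      idOn (rightIdeal {y}) (isFG_singleton y) := by
  refine ext_maps fun a b => ?_
  simp only [maps_mul, maps_idOn, maps_translate, mem_rightIdeal_singleton]
  constructor
  · rintro ⟨c, ⟨w, h1, h2⟩, d, ⟨-, rfl⟩, w', h3, h4⟩
    obtain rfl := G.mul_left_cancel h2 h3
    exact ⟨⟨w, h1⟩, h4.unique h1⟩
  · rintro ⟨⟨w, hw⟩, rfl⟩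
    obtain ⟨c, hc⟩ := exists_isProd (hw.left_eq.trans h.symm)
    exact ⟨c, ⟨w, hw, hc⟩, c, ⟨⟨w, hc⟩, rfl⟩, w, hc, hw⟩

/-- An additive ideal of `B(C)` that contains the classes of the identities on `yC` for all
`y ∈ Y` contains that of the identity on `YC`. -/
theorem idOn_mem_of_forall {I : Set (B C)} (hI : IsAdditiveIdeal I) {Y : Set (Arrow C)}
    (hY : Y.Finite)
    (h : ∀ y ∈ Y, toB (idOn (rightIdeal {y}) (isFG_singleton y)) ∈ I) :
    toB (idOn (rightIdeal Y) (isFG_rightIdeal hY)) ∈ I := by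
  induction Y, hY using Set.Finite.induction_on with
  | empty =>
    convert hI.1.zero_mem
    rw [toB_eq_zero_iff]
    refine ext_maps fun a b => iff_of_false ?_ (not_maps_zero a b)
    rw [maps_idOn]
    rintro ⟨⟨x, hx, _⟩, _⟩
    exact hx
  | @insert y Y hyY hY ih =>
    have h1 := h y (Set.mem_insert _ _)
    have h2 := ih fun z hz => h z (Set.mem_insert_of_mem _ hz)
    have idem : ∀ (P : Set (Arrow C)) (hP : IsFG P),
        toB (idOn P hP) * toB (idOn P hP) = toB (idOn P hP) := fun P hP => by
      rw [← toB_mul, idOn_mul_idOn hP hP subset_rfl]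
    -- Idempotents are compatible, so the ideal contains a join of the two classes. Only its being
    -- an upper bound matters: it dominates the identity on the union, and ideals are closed
    -- downwards.
    obtain ⟨q, hq, hq1, hq2, -⟩ := hI.2 _ h1 _ h2 (compatible_of_idem (idem _ _) (idem _ _))
    refine hI.1.mem_of_natLE ?_ hq
    obtain ⟨c, rfl⟩ := toB_surjective q
    rw [natLE_toB_iff] at *
    intro a b hab
    obtain ⟨ha, rfl⟩ := maps_idOn.1 hab
    rw [Set.insert_eq, rightIdeal_union] at ha
    rcases ha with ha | ha
    · exact hq1 _ _ (maps_idOn.2 ⟨ha, rfl⟩)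
    · exact hq2 _ _ (maps_idOn.2 ⟨ha, rfl⟩)

include G in
theorem isZeroSimplifying_of_isCofinal (hC : IsCofinal C) : IsZeroSimplifying (B C) := by
  intro I hI
  by_cases hI0 : I ⊆ {0}
  · exact Or.inl (hI0.antisymm (Set.singleton_subset_iff.2 hI.1.zero_mem))
  right
  obtain ⟨q, hq, hq0⟩ := Set.not_subset.1 hI0
  obtain ⟨s, rfl⟩ := toB_surjective q
  obtain ⟨a, b, hab⟩ := ne_zero_iff.1 (mt toB_eq_zero_iff.2 hq0)
  -- Since `s` is defined on aC, restricting `s⁻¹ * s` to aC yields the identity there.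
  have ha : toB (idOn (rightIdeal {a}) (isFG_singleton a)) ∈ I := by
    have h1 := (hI.1.2 _ (hI.1.2 _ hq (toB s⁻¹)).1
      (toB (idOn (rightIdeal {a}) (isFG_singleton a)))).2
    rw [← toB_mul, ← toB_mul] at h1
    convert h1 using 2
    refine ext_maps fun p p' => ?_
    simp only [maps_mul, maps_idOn, maps_inv]
    constructor
    · rintro ⟨hp, rfl⟩
      obtain ⟨w, hw⟩ := mem_rightIdeal_singleton.1 hp
      obtain ⟨d, hd, _⟩ := hab.exists_mul hw
      exact ⟨_, ⟨hp, rfl⟩, d, hd, hd⟩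
    · rintro ⟨c, ⟨hp, rfl⟩, d, hd, hd'⟩
      exact ⟨hp, hd'.inj hd⟩
  have hx : ∀ x : Arrow C, Nonempty (x.left ⟶ a.left) →
      toB (idOn (rightIdeal {x}) (isFG_singleton x)) ∈ I := by
    rintro x ⟨u⟩
    -- w = au lies in aC and has the same domain as x, which links the identity on aC to that on xC.
    obtain ⟨w, hw⟩ := exists_isProd (a := a) (b := Arrow.mk u) rfl
    have hwx : w.left = x.left := hw.dom_eq
    have h1 : toB (idOn (rightIdeal {w}) (isFG_singleton w)) ∈ I := by
      have h2 := (hI.1.2 _ ha (toB (idOn (rightIdeal {w}) (isFG_singleton w)))).1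
      rwa [← toB_mul, idOn_mul_idOn] at h2
      intro p hp
      obtain ⟨v, hv⟩ := mem_rightIdeal_singleton.1 hp
      exact rightIdeal_mul (mem_rightIdeal_singleton.2 ⟨_, hw⟩) hv
    rw [← translate_mul_idOn_mul G hwx, toB_mul, toB_mul]
    exact (hI.1.2 _ (hI.1.2 _ h1 _).1 _).2
  -- The sets for the various f have a finite union because C has finitely many identities.
  choose X hX hlarge hhom using hC a.left
  have hY := idOn_mem_of_forall hI (Set.finite_iUnion hX) (fun y hy => by
    obtain ⟨f, hf⟩ := Set.mem_iUnion.1 hy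
    exact hx y (hhom f y hf))
  have hone : (1 : B C) ∈ I := by
    convert hY using 1
    rw [← toB_one, toB_eq_iff]
    constructor
    · intro p p' hp
      obtain rfl := maps_one.1 hp
      -- Largeness is what makes 1 eventually agree with the identity on YC: every arrow has an
      -- extension in YC.
      obtain ⟨x, hxX, hd⟩ := (hlarge p'.right).2 p' (mem_rightIdeal_id.2 rfl)
      obtain ⟨v, t, c, hv, ht⟩ := dependent_iff.1 hd
      exact ⟨v, c, c, hv, hv, maps_idOn.2 ⟨⟨x, Set.mem_iUnion.2 ⟨_, hxX⟩, t, ht⟩, rfl⟩⟩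
    · exact eventuallyLE_of_natLE (natLE_iff.2 fun p p' hp => maps_one.2 (maps_idOn.1 hp).2)
  refine Set.eq_univ_of_forall fun r => ?_
  simpa using (hI.1.2 _ hone r).1

/-! ### 0-simplifying implies cofinal -/

/-- The classes of those `s` for which there is an arrow from `d(a)` to `e` whenever `s(a)` is
defined. -/
def reachIdeal (e : C) : Set (B C) :=
  toB '' {s : R C | ∀ a b, s.Maps a b → Nonempty (a.left ⟶ e)}

include G in
-- Elements of R(C) preserve the domains of arrows, so the condition survives multiplication on
-- either side; it survives joins because these are represented by unions.
theorem isAdditiveIdeal_reachIdeal (e : C) : IsAdditiveIdeal (reachIdeal e) := by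
  refine ⟨⟨⟨toB 0, 0, fun a b h => (not_maps_zero a b h).elim, rfl⟩, ?_⟩, ?_⟩
  · rintro _ ⟨s, hs, rfl⟩ q
    obtain ⟨r, rfl⟩ := toB_surjective q
    refine ⟨⟨r * s, fun a b h => ?_, rfl⟩, ⟨s * r, fun a b h => ?_, rfl⟩⟩
    · obtain ⟨c, hc, _⟩ := maps_mul.1 h
      exact hs a c hc
    · obtain ⟨c, hc, hb⟩ := maps_mul.1 h
      rw [← hc.left_eq]
      exact hs c b hb
  · rintro _ ⟨s, hs, rfl⟩ _ ⟨t, ht, rfl⟩ h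
    obtain ⟨c, hc, hst⟩ := exists_isJoin G h
    exact ⟨_, ⟨c, fun a b hab => (hst a b hab).elim (hs a b) (ht a b), rfl⟩, hc⟩

include G in
theorem isCofinal_of_isZeroSimplifying (h : IsZeroSimplifying (B C)) : IsCofinal C := by
  intro e f
  have huniv : reachIdeal e = Set.univ := by
    refine (h _ (isAdditiveIdeal_reachIdeal G e)).resolve_left fun h0 => ?_
    have hmem : toB (idOn (rightIdeal {Arrow.mk (𝟙 e)}) (isFG_singleton _)) ∈ reachIdeal e := by
      refine ⟨_, fun a b hab => ?_, rfl⟩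
      obtain rfl := mem_rightIdeal_id.1 (maps_idOn.1 hab).1
      exact ⟨a.hom⟩
    rw [h0, Set.mem_singleton_iff, toB_eq_zero_iff] at hmem
    exact ne_zero_iff.2 ⟨Arrow.mk (𝟙 e), _, maps_idOn.2 ⟨mem_rightIdeal_id.2 rfl, rfl⟩⟩ hmem
  obtain ⟨s, hs, hs1⟩ : (1 : B C) ∈ reachIdeal e := huniv ▸ Set.mem_univ _
  rw [← toB_one, toB_eq_iff] at hs1
  obtain ⟨X, hX, hdom⟩ := s.fg_dom
  -- As s ≡ 1, each b in fC has an extension bw in the domain XC of `s`; the generator it comes from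
  -- shares the codomain f, so it belongs to the chosen subset.
  refine ⟨{x ∈ X | x.right = f}, hX.subset fun x hx => hx.1,
    ⟨fun x hx => mem_rightIdeal_id.2 hx.2, fun b hb => ?_⟩, fun x hx => ?_⟩
  · obtain ⟨w, c, d, hc, -, hcd⟩ := hs1.2 b b (maps_one.2 rfl)
    have hcX : c ∈ rightIdeal X := hdom ▸ ⟨d, hcd⟩
    obtain ⟨x, hx, t, ht⟩ := hcX
    exact ⟨x, ⟨hx, ht.cod_eq.symm.trans (hc.cod_eq.trans (mem_rightIdeal_id.1 hb))⟩,
      dependent_iff.2 ⟨w, t, c, hc, ht⟩⟩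
  · have hxX : x ∈ {a | ∃ b, b ∈ s.toPEquiv a} := hdom ▸ mem_rightIdeal_self hx.1
    obtain ⟨b, hb⟩ := hxX
    exact hs x b hb

end Monoid

end R

end Categories

end HigherRank

theorem mainTheorem5 {C : Type u} [CategoryTheory.Category.{v} C] {k : ℕ}
    (G : HigherRank.KGraph k C) [Finite C] [HigherRank.StronglyFinitelyAligned C]
    (hns : G.NoSources) (hrf : G.RowFinite) :
    HigherRank.IsCofinal C ↔ HigherRank.IsZeroSimplifying (HigherRank.B C) :=
  ⟨HigherRank.R.isZeroSimplifying_of_isCofinal G, HigherRank.R.isCofinal_of_isZeroSimplifying G⟩
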